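/- Let $\omega=(Z_k,E_k)_{k\in\mathbb Z}$ be a random environment with $Z_k\in(0,\infty)$, $E_k\in\mathbb R$, with law $\mathbb P$ and expectation $\mathbb E$, and let $\tau_\ell\omega:=(Z_{k+\ell},E_{k+\ell})_{k\in\mathbb Z}$ for $\ell\in\mathbb Z$. Assume: (A1) $(Z_k,E_k)_{k\in\mathbb Z}$ is stationary and ergodic with respect to shifts; (A2) $\mathbb E[Z_0]<\infty$; (A3) $\mathbb P(\omega=\tau_\ell\omega)=0$ for all $\ell\in\mathbb Z\setminus\{0\}$; (A4) there is $d>0$ with $\mathbb P(Z_0\ge d)=1$. Let $(x_k)_{k\in\mathbb Z}$ be given by $x_0=0$ and $x_{k+1}=x_k+Z_k$, let $u:\mathbb R\times\mathbb R\to\mathbb R$ be measurable, symmetric and bounded, and fix $\lambda\in(0,1)$. For $i\neq j$ in $\mathbb Z$ put $$c_{i,j}(\omega)=\exp\{\lambda(x_i+x_j)-|x_j-x_i|+u(E_i,E_j)\},\qquad c_{i,i}(\omega)=0 .$$ For $\mathbb P$-a.e. $\omega$ and $i\in\mathbb Z$, let $P^{\omega,\infty}_i$ be the law of the discrete-time Markov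 chain $(X_n)_{n\ge0}$ on $\mathbb Z$ started at $i$ whose probability to jump from $k$ to $j$ in one step is $c_{k,j}(\omega)/\sum_{l\in\mathbb Z}c_{k,l}(\omega)$. If $$\mathbb E\Big[\Big(\sup_{z\le 0}P^{\omega,\infty}_z(X_1\ge 1)\Big)^{-1}\Big]=\infty ,\qquad(\ast)$$ then the walk has zero velocity, that is, for $\mathbb P$-a.e. $\omega$, $\lim_{n\to\infty}X_n/n=0$ holds $P^{\omega,\infty}_0$-almost surely. Moreover, condition $(\ast)$ is equivalent to $\mathbb E\big[e^{(1-\lambda)Z_0-(1+\lambda)Z_{-1}}\big]=\infty$. -/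

import Mathlib

open MeasureTheory ProbabilityTheory Filter Topology
open scoped ENNReal

noncomputable section

namespace MottWalk

/-- Environments `ω = (Z_k, E_k)_{k ∈ ℤ}` with `Z_k ∈ (0, ∞)` and `E_k ∈ ℝ`, with the product
`σ`-algebra. -/
abbrev Environment : Type := ℤ → Set.Ioi (0 : ℝ) × ℝ

/-- The interpoint distance `Z_k`. -/
def gap (ω : Environment) (k : ℤ) : ℝ := ((ω k).1 : ℝ)

/-- The energy mark `E_k`. -/
def mark (ω : Environment) (k : ℤ) : ℝ := (ω k).2

/-- The shift `τ_ℓ ω = (Z_{k+ℓ}, E_{k+ℓ})_{k ∈ ℤ}`. -/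
def shift (l : ℤ) (ω : Environment) : Environment := fun k => ω (k + l)

/-- The points `x_k`, determined by `x_0 = 0` and `x_{k+1} = x_k + Z_k` for all `k ∈ ℤ`
(one of the two sums is always empty). -/
def point (ω : Environment) (k : ℤ) : ℝ :=
  (∑ i ∈ Finset.Ico 0 k, gap ω i) - ∑ i ∈ Finset.Ico k 0, gap ω i

/-- The standing assumptions on the law `P` of the environment. -/
structure IsAdmissible (P : Measure Environment) : Prop where
  /-- The environment is stationary and ergodic with respect to shifts. -/
  ergodic : Ergodic (shift 1) P
  /-- `Z_0` has finite mean. -/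
  integrable : Integrable (fun ω => gap ω 0) P
  /-- The environment is almost surely not periodic. -/
  aperiodic : ∀ l : ℤ, l ≠ 0 → P {ω | ω = shift l ω} = 0
  /-- Interpoint distances are bounded away from zero. -/
  separated : ∃ d : ℝ, 0 < d ∧ ∀ᵐ ω ∂P, d ≤ gap ω 0

/-- The conductances `c_{i,j} = exp (lam (x_i + x_j) - |x_j - x_i| + u (E_i, E_j))` for `i ≠ j`,
and `c_{i,i} = 0`. -/
def conductance (u : ℝ → ℝ → ℝ) (lam : ℝ) (ω : Environment) (i j : ℤ) : ℝ :=
  if i = j then 0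
  else Real.exp (lam * (point ω i + point ω j) - |point ω j - point ω i|
    + u (mark ω i) (mark ω j))

theorem tsum_conductance_ne_zero (u : ℝ → ℝ → ℝ) (lam : ℝ) (ω : Environment) (i : ℤ) :
    ∑' j, ENNReal.ofReal (conductance u lam ω i j) ≠ 0 := by
  intro h
  have h1 := ENNReal.tsum_eq_zero.1 h (i + 1)
  rw [conductance, if_neg (by omega), ENNReal.ofReal_eq_zero] at h1
  exact absurd h1 (not_le.2 (Real.exp_pos _))

open Classical in
/-- The law of one step from `i`: the walk jumps to `j` with probability
`c_{i,j} / ∑ k, c_{i,k}`. In the exceptional environments where the total conductance at `i` is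
infinite (a null event under `IsAdmissible`) the walk is declared to stay put. -/
def stepLaw (u : ℝ → ℝ → ℝ) (lam : ℝ) (ω : Environment) (i : ℤ) : PMF ℤ :=
  if h : ∑' j, ENNReal.ofReal (conductance u lam ω i j) ≠ ∞ then
    PMF.normalize (fun j => ENNReal.ofReal (conductance u lam ω i j))
      (tsum_conductance_ne_zero u lam ω i) h
  else PMF.pure i

/-- The transition kernel on `ℤ` in the environment `ω`. -/
def stepKernel (u : ℝ → ℝ → ℝ) (lam : ℝ) (ω : Environment) : Kernel ℤ ℤ where
  toFun i := (stepLaw u lam ω i).toMeasure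
  measurable' := measurable_from_top

instance (u : ℝ → ℝ → ℝ) (lam : ℝ) (ω : Environment) :
    IsMarkovKernel (stepKernel u lam ω) :=
  ⟨fun i => inferInstanceAs (IsProbabilityMeasure (stepLaw u lam ω i).toMeasure)⟩

/-- The Markov transition from the history up to time `n` to time `n + 1`: only the position at
time `n` matters. -/
def historyKernel (u : ℝ → ℝ → ℝ) (lam : ℝ) (ω : Environment) (n : ℕ) :
    Kernel ((_ : Finset.Iic n) → ℤ) ℤ :=
  (stepKernel u lam ω).comap (fun x => x ⟨n, Finset.mem_Iic.2 le_rfl⟩) (measurable_pi_apply _)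

instance (u : ℝ → ℝ → ℝ) (lam : ℝ) (ω : Environment) (n : ℕ) :
    IsMarkovKernel (historyKernel u lam ω n) := by
  unfold historyKernel; infer_instance

/-- The quenched law, on trajectories `(X_n)_{n ≥ 0}` in `ℤ`, of the discrete-time walk in the
environment `ω` started at `i`. -/
def walkLaw (u : ℝ → ℝ → ℝ) (lam : ℝ) (ω : Environment) (i : ℤ) : Measure (ℕ → ℤ) :=
  Kernel.traj (X := fun _ => ℤ) (historyKernel u lam ω) 0 (fun _ => i)

/-- The walk has asymptotic velocity `v`: for `P`-almost every environment, `X_n / n → v` almost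
surely for the walk started at `0`. -/
def HasVelocity (P : Measure Environment) (u : ℝ → ℝ → ℝ) (lam v : ℝ) : Prop :=
  ∀ᵐ ω ∂P, ∀ᵐ X ∂(walkLaw u lam ω 0),
    Tendsto (fun n : ℕ => (X n : ℝ) / (n : ℝ)) atTop (𝓝 v)

end MottWalk

end

/-! No negative speed: the total conductance `π` is a reversible measure, so `P_0(X_n = j) ≤ π(j) /
π(0)`. Since `π(-n)` decays like `exp (-2 lam d n)`, Borel–Cantelli forbids `X_n < -a n` infinitely
often, for every `a > 0`.

No positive speed: each site `k` acts as a barrier. From any `z ≤ k` one step passes `k` with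
probability at most `p_k = K / (1 + W_k)` (`stepKernel_Ici_succ_le`), and, since conductances to the
right decay geometrically, a walk that jumps to `k` or beyond lands on `k` itself with probability
at least `ε` (`stepKernel_Ici_le`). So on the way to level `N` each site costs, with chance `ε`, a
geometric time of mean about `W_k`; as `W` has infinite mean, the passage time exceeds every
multiple of `N`.

This is made quantitative by discounting each step by `1 / (1 + t)`. A geometric time of parameter
`p` has discount `p / (t + p)`, and the resulting product along the running maximum is a
supermartingale (`integral_recordDiscount_max_le`). It gives `P_0(X_n ≥ N) ≤ exp (t n - ε t ∑_{i <
N} 1 / (t + p_i))` (`walkLaw_ge_le`). The mean of `1 / (t + p_0)` is as large as desired for small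
`t`, and the ergodic theorem, needed only as a lower bound for bounded functions, makes the exponent
at most a constant minus `3 t n` when `N` is about `a n`.

Finally, the supremum in the crossing condition lies between constant multiples of `1 / (1 + W_0)`,
whence the equivalence. -/

/-- The maximum of `0` and of the first `n` Birkhoff sums of `g`, defined by its one-step
recursion along the orbit. -/
def maxBirkhoffSum {α : Type*} (T : α → α) (g : α → ℝ) : ℕ → α → ℝ
  | 0, _ => 0
  | n + 1, x => max 0 (g x + maxBirkhoffSum T g n (T x))

/-! ### Maximal ergodic lemma and a one-sided ergodic theorem -/

section MaxBirkhoffSum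

variable {α : Type*} (T : α → α) (g : α → ℝ)

theorem maxBirkhoffSum_nonneg (n : ℕ) (x : α) : 0 ≤ maxBirkhoffSum T g n x := by
  cases n with
  | zero => exact le_rfl
  | succ n => exact le_max_left _ _

theorem maxBirkhoffSum_le_succ (n : ℕ) (x : α) :
    maxBirkhoffSum T g n x ≤ maxBirkhoffSum T g (n + 1) x := by
  induction n generalizing x with
  | zero => exact maxBirkhoffSum_nonneg T g 1 x
  | succ n ih => exact max_le_max le_rfl (by linarith [ih (T x)])

theorem maxBirkhoffSum_mono (x : α) : Monotone fun n => maxBirkhoffSum T g n x :=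
  monotone_nat_of_le_succ fun n => maxBirkhoffSum_le_succ T g n x

theorem birkhoffSum_le_maxBirkhoffSum (n : ℕ) (x : α) :
    birkhoffSum T g n x ≤ maxBirkhoffSum T g n x := by
  induction n generalizing x with
  | zero => simp [maxBirkhoffSum]
  | succ n ih =>
    rw [birkhoffSum_succ']
    exact le_max_of_le_right (by linarith [ih (T x)])

theorem maxBirkhoffSum_le (C : ℝ) (hg : ∀ x, |g x| ≤ C) (n : ℕ) (x : α) :
    maxBirkhoffSum T g n x ≤ n * C := by
  have hC : 0 ≤ C := (abs_nonneg _).trans (hg x)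
  induction n generalizing x with
  | zero => simp [maxBirkhoffSum]
  | succ n ih =>
    refine max_le (by positivity) ?_
    push_cast
    linarith [ih (T x), (abs_le.1 (hg x)).2]

/-- Boundedness is thus a shift-invariant event, to which the zero-one law of an ergodic map
applies. -/
theorem bddAbove_maxBirkhoffSum_comp_iff (x : α) :
    BddAbove (Set.range fun n => maxBirkhoffSum T g n (T x)) ↔
      BddAbove (Set.range fun n => maxBirkhoffSum T g n x) := by
  constructor
  · rintro ⟨B, hB⟩
    refine ⟨max 0 (g x + B), ?_⟩
    rintro _ ⟨n, rfl⟩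
    cases n with
    | zero => exact le_max_left _ _
    | succ n => exact max_le_max le_rfl (by linarith [hB ⟨n, rfl⟩])
  · rintro ⟨B, hB⟩
    refine ⟨B - g x, ?_⟩
    rintro _ ⟨n, rfl⟩
    have h1 : maxBirkhoffSum T g (n + 1) x ≤ B := hB ⟨n + 1, rfl⟩
    have h2 := (le_max_right 0 (g x + maxBirkhoffSum T g n (T x))).trans h1
    change maxBirkhoffSum T g n (T x) ≤ _
    linarith

variable {T g}

theorem measurable_maxBirkhoffSum [MeasurableSpace α] (hT : Measurable T) (hg : Measurable g)
    (n : ℕ) : Measurable (maxBirkhoffSum T g n) := by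
  induction n with
  | zero => exact measurable_const
  | succ n ih => exact measurable_const.max (hg.add (ih.comp hT))

/-- For an ergodic map, the partial sums of a bounded function with negative mean are almost surely
bounded above. -/
theorem Ergodic.ae_bddAbove_maxBirkhoffSum [MeasurableSpace α] {μ : Measure α}
    [IsProbabilityMeasure μ] (hT : Ergodic T μ) (hg : Measurable g) {C : ℝ}
    (hC : ∀ x, |g x| ≤ C) (hneg : ∫ x, g x ∂μ < 0) :
    ∀ᵐ x ∂μ, BddAbove (Set.range fun n => maxBirkhoffSum T g n x) := by
  have hTm : Measurable T := hT.toMeasurePreserving.measurable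
  have hG := measurable_maxBirkhoffSum hTm hg
  have hmeas : MeasurableSet {x | BddAbove (Set.range fun n => maxBirkhoffSum T g n x)} :=
    measurableSet_bddAbove_range hG
  rcases hT.toPreErgodic.ae_mem_or_ae_notMem hmeas
    (Set.ext fun x => bddAbove_maxBirkhoffSum_comp_iff T g x) with h | h
  · exact h
  exfalso
  have hC0 : 0 ≤ C := by
    obtain ⟨x⟩ : Nonempty α := μ.nonempty_of_neZero
    exact (abs_nonneg _).trans (hC x)
  have hint : ∀ n, Integrable (maxBirkhoffSum T g n) μ := fun n =>
    Integrable.of_bound (hG n).aestronglyMeasurable (n * C) (ae_of_all _ fun x => by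
      rw [Real.norm_of_nonneg (maxBirkhoffSum_nonneg T g n x)]
      exact maxBirkhoffSum_le T g C hC n x)
  -- If the maxima are unbounded, `maxBirkhoffSum T g n (T x)` tends to infinity, so the integrand
  -- eventually equals `g x`.
  have hlim : Tendsto (fun n => ∫ x, max (-maxBirkhoffSum T g n (T x)) (g x) ∂μ) atTop
      (𝓝 (∫ x, g x ∂μ)) := by
    refine tendsto_integral_of_dominated_convergence (fun _ => C)
      (fun n => (((hG n).comp hTm).neg.max hg).aestronglyMeasurable) (integrable_const _)
      (fun n => ae_of_all _ fun x => ?_) ?_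
    · rw [Real.norm_eq_abs, abs_le]
      refine ⟨le_max_of_le_right (abs_le.1 (hC x)).1, max_le ?_ (abs_le.1 (hC x)).2⟩
      linarith [maxBirkhoffSum_nonneg T g n (T x)]
    · filter_upwards [h] with x hx
      have hx' : Tendsto (fun n => maxBirkhoffSum T g n (T x)) atTop atTop :=
        tendsto_atTop_atTop_of_monotone' (maxBirkhoffSum_mono T g (T x))
          (fun hb => hx ((bddAbove_maxBirkhoffSum_comp_iff T g x).1 hb))
      refine tendsto_const_nhds.congr' ?_
      filter_upwards [hx'.eventually_ge_atTop C] with n hn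
      rw [max_eq_right]
      linarith [(abs_le.1 (hC x)).1]
  refine absurd (ge_of_tendsto' hlim fun n => ?_) (not_le.2 hneg)
  have hcomp : Integrable (fun x => maxBirkhoffSum T g n (T x)) μ :=
    hT.toMeasurePreserving.integrable_comp_of_integrable (hint n)
  have hint_eq : ∫ x, maxBirkhoffSum T g n (T x) ∂μ = ∫ x, maxBirkhoffSum T g n x ∂μ := by
    have := integral_map (μ := μ) hTm.aemeasurable (f := maxBirkhoffSum T g n)
      (hG n).aestronglyMeasurable
    rw [hT.toMeasurePreserving.map_eq] at this
    exact this.symm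
  -- The integrand is an increment of the maxima up to composition with `T`. By invariance of `μ`
  -- and monotonicity in `n` its integral is nonnegative, against the negative limit.
  have hstep : (fun x => max (-maxBirkhoffSum T g n (T x)) (g x)) =
      fun x => maxBirkhoffSum T g (n + 1) x - maxBirkhoffSum T g n (T x) := by
    funext x
    change _ = max 0 (g x + maxBirkhoffSum T g n (T x)) - maxBirkhoffSum T g n (T x)
    rw [← max_sub_sub_right]
    simp
  rw [hstep, integral_sub (hint _) hcomp, hint_eq, sub_nonneg]
  exact integral_mono (hint _) (hint _) fun x => maxBirkhoffSum_le_succ T g n x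

/-- Lower bound in the pointwise ergodic theorem. -/
theorem Ergodic.ae_eventually_le_birkhoffSum [MeasurableSpace α] {μ : Measure α}
    [IsProbabilityMeasure μ] (hT : Ergodic T μ) (hg : Measurable g) {C : ℝ}
    (hC : ∀ x, |g x| ≤ C) {c : ℝ} (hc : c < ∫ x, g x ∂μ) :
    ∀ᵐ x ∂μ, ∀ᶠ n : ℕ in atTop, c * n ≤ birkhoffSum T g n x := by
  have hgi : Integrable g μ := Integrable.of_bound hg.aestronglyMeasurable C (ae_of_all _ hC)
  -- The room between `c` and `b` absorbs the random bound `B` once `(b - c) n ≥ B`.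
  obtain ⟨b, hcb, hb⟩ := exists_between hc
  have hneg : ∫ x, (b - g x) ∂μ < 0 := by
    rw [integral_sub (integrable_const _) hgi]
    simpa using hb
  filter_upwards [hT.ae_bddAbove_maxBirkhoffSum (g := fun x => b - g x) (measurable_const.sub hg)
    (C := |b| + C) (fun x => (abs_sub _ _).trans (by linarith [hC x])) hneg] with x hx
  obtain ⟨B, hB⟩ := hx
  have hlarge : ∀ᶠ n : ℕ in atTop, B / (b - c) ≤ (n : ℝ) :=
    tendsto_natCast_atTop_atTop.eventually_ge_atTop _
  filter_upwards [hlarge] with n hn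
  have h1 := (birkhoffSum_le_maxBirkhoffSum T (fun x => b - g x) n x).trans (hB ⟨n, rfl⟩)
  have h2 : birkhoffSum T (fun x => b - g x) n x = n * b - birkhoffSum T g n x := by
    simp [birkhoffSum, Finset.sum_sub_distrib]
  rw [div_le_iff₀ (sub_pos.2 hcb)] at hn
  rw [h2] at h1
  nlinarith

end MaxBirkhoffSum

/-! ### Markov property of the trajectory law -/

namespace MottWalk

instance (u : ℝ → ℝ → ℝ) (lam : ℝ) (ω : Environment) (i : ℤ) :
    IsProbabilityMeasure (walkLaw u lam ω i) := by
  unfold walkLaw; infer_instance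

/-- The Markov property at time `n`, for a functional `M` of the trajectory up to time `n`. -/
theorem lintegral_walkLaw_succ {α : Type*} (u : ℝ → ℝ → ℝ) (lam : ℝ) (ω : Environment) (i : ℤ)
    (n : ℕ) (M : (ℕ → ℤ) → α) (hM : ∀ X : ℕ → ℤ, M (fun k => X (min k n)) = M X)
    (F : α → ℤ → ℝ≥0∞) :
    ∫⁻ X, F (M X) (X (n + 1)) ∂walkLaw u lam ω i =
      ∫⁻ X, ∫⁻ j, F (M X) j ∂(stepKernel u lam ω (X n)) ∂walkLaw u lam ω i := by
  -- A finite history is continued by freezing it at time `n`; by `hM` the functional `M` does not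
  -- see the difference.
  let ext : ((_ : Finset.Iic n) → ℤ) → ℕ → ℤ :=
    fun h k => h ⟨min k n, Finset.mem_Iic.2 (min_le_right _ _)⟩
  let G : ((_ : Finset.Iic n) → ℤ) × ℤ → ℝ≥0∞ := fun y => F (M (ext y.1)) y.2
  have hG : Measurable G := measurable_of_countable _
  have hext : ∀ X : ℕ → ℤ, M (ext (Preorder.frestrictLe (π := fun _ => ℤ) n X)) = M X := hM
  have hmap : Measurable fun X : ℕ → ℤ =>
      (Preorder.frestrictLe (π := fun _ => ℤ) n X, X (n + 1)) := by fun_prop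
  have h1 := congrArg (fun m => ∫⁻ y, G y ∂m)
    (Kernel.partialTraj_compProd_eq_map_traj (X := fun _ => ℤ) (κ := historyKernel u lam ω)
      (Nat.zero_le n) (x₀ := fun _ => i))
  rw [lintegral_map hG hmap, Measure.lintegral_compProd hG,
    ← Kernel.traj_map_frestrictLe_apply, lintegral_map (measurable_of_countable _)
      (by fun_prop)] at h1
  simp only [G, hext] at h1
  exact h1.symm

/-- The walk starts at its starting point. -/
theorem ae_walkLaw_zero (u : ℝ → ℝ → ℝ) (lam : ℝ) (ω : Environment) (i : ℤ) :
    ∀ᵐ X ∂walkLaw u lam ω i, X 0 = i := by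
  have h := Kernel.traj_map_frestrictLe_apply (X := fun _ => ℤ) (κ := historyKernel u lam ω) 0 0
    (fun _ => i)
  rw [Kernel.partialTraj_self, Kernel.id_apply] at h
  have h2 : ∀ᵐ y ∂((Kernel.traj (X := fun _ => ℤ) (historyKernel u lam ω) 0 (fun _ => i)).map
      (Preorder.frestrictLe 0)), y ⟨0, Finset.mem_Iic.2 le_rfl⟩ = i := by
    rw [h, ae_dirac_iff (measurableSet_eq_fun (measurable_pi_apply _) measurable_const)]
  exact ae_of_ae_map (by fun_prop) h2

theorem walkLaw_one (u : ℝ → ℝ → ℝ) (lam : ℝ) (ω : Environment) (i : ℤ) (S : Set ℤ) :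
    walkLaw u lam ω i {X | X 1 ∈ S} = (stepKernel u lam ω i) S := by
  have h := lintegral_walkLaw_succ u lam ω i 0 (fun _ => ()) (fun _ => rfl)
    (fun _ => S.indicator 1)
  have hS : MeasurableSet S := S.to_countable.measurableSet
  have hS' : MeasurableSet {X : ℕ → ℤ | X 1 ∈ S} := (measurable_pi_apply 1) hS
  simp only [lintegral_indicator_one hS, zero_add] at h
  rw [← lintegral_indicator_one hS']
  refine Eq.trans h ?_
  rw [lintegral_congr_ae ((ae_walkLaw_zero u lam ω i).mono fun X hX => by rw [hX])]
  simp

/-- One step of the marginal law of the walk. -/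
theorem walkLaw_succ_eq (u : ℝ → ℝ → ℝ) (lam : ℝ) (ω : Environment) (i j : ℤ) (n : ℕ) :
    walkLaw u lam ω i {X | X (n + 1) = j} =
      ∑' k, stepLaw u lam ω k j * walkLaw u lam ω i {X | X n = k} := by
  have h := lintegral_walkLaw_succ u lam ω i n (fun _ => ()) (fun _ => rfl)
    (fun _ => Set.indicator {j} 1)
  have hS' : MeasurableSet {X : ℕ → ℤ | X (n + 1) = j} :=
    measurableSet_eq_fun (measurable_pi_apply _) measurable_const
  rw [← lintegral_indicator_one hS']
  refine Eq.trans h ?_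
  simp only [lintegral_indicator_one (MeasurableSet.singleton j)]
  have hmeas : Measurable fun X : ℕ → ℤ => X n := measurable_pi_apply n
  rw [← lintegral_map (f := fun k => stepKernel u lam ω k {j}) (measurable_of_countable _) hmeas,
    lintegral_countable']
  refine tsum_congr fun k => ?_
  rw [Measure.map_apply hmeas (MeasurableSet.singleton k)]
  congr 1
  exact PMF.toMeasure_apply_singleton _ _ (MeasurableSet.singleton _)

/-! ### Points, conductances and barriers -/

theorem gap_pos (ω : Environment) (k : ℤ) : 0 < gap ω k := (ω k).1.2

theorem point_succ (ω : Environment) (k : ℤ) : point ω (k + 1) = point ω k + gap ω k := by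
  unfold point
  rcases le_or_gt 0 k with hk | hk
  · have h1 : Finset.Ico 0 (k + 1) = insert k (Finset.Ico 0 k) := by
      ext i; simp only [Finset.mem_Ico, Finset.mem_insert]; omega
    rw [h1, Finset.sum_insert (by simp), Finset.Ico_eq_empty (by omega : ¬ k + 1 < 0),
      Finset.Ico_eq_empty (by omega : ¬ k < 0)]
    simp only [Finset.sum_empty]; ring
  · have h1 : Finset.Ico k 0 = insert k (Finset.Ico (k + 1) 0) := by
      ext i; simp only [Finset.mem_Ico, Finset.mem_insert]; omega
    rw [h1, Finset.sum_insert (by simp), Finset.Ico_eq_empty (by omega : ¬ 0 < k + 1),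
      Finset.Ico_eq_empty (by omega : ¬ 0 < k)]
    simp only [Finset.sum_empty]; ring

theorem point_zero (ω : Environment) : point ω 0 = 0 := by simp [point]

theorem le_point_sub {d : ℝ} {ω : Environment} (hω : ∀ k, d ≤ gap ω k) (k : ℤ) (n : ℕ) :
    n * d ≤ point ω (k + n) - point ω k := by
  induction n with
  | zero => simp
  | succ n ih =>
    have h := point_succ ω (k + n)
    push_cast at h ⊢
    rw [← add_assoc, h]
    linarith [hω (k + n)]

theorem point_mono (ω : Environment) : Monotone (point ω) :=
  monotone_int_of_le_succ fun k => by rw [point_succ]; linarith [gap_pos ω k]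

theorem conductance_nonneg (u : ℝ → ℝ → ℝ) (lam : ℝ) (ω : Environment) (i j : ℤ) :
    0 ≤ conductance u lam ω i j := by
  unfold conductance; split_ifs <;> positivity

theorem conductance_symm {u : ℝ → ℝ → ℝ} (hu : ∀ a b, u a b = u b a) (lam : ℝ) (ω : Environment)
    (i j : ℤ) : conductance u lam ω i j = conductance u lam ω j i := by
  unfold conductance
  simp only [eq_comm (a := i), abs_sub_comm (point ω j), add_comm (point ω i), hu (mark ω i)]

theorem conductance_of_lt (u : ℝ → ℝ → ℝ) (lam : ℝ) (ω : Environment) {i j : ℤ} (h : i < j) :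
    conductance u lam ω i j = Real.exp (lam * (point ω i + point ω j) - (point ω j - point ω i)
      + u (mark ω i) (mark ω j)) := by
  rw [conductance, if_neg h.ne, abs_of_nonneg (sub_nonneg.2 (point_mono ω h.le))]

theorem conductance_of_gt (u : ℝ → ℝ → ℝ) (lam : ℝ) (ω : Environment) {i j : ℤ} (h : j < i) :
    conductance u lam ω i j = Real.exp (lam * (point ω i + point ω j) - (point ω i - point ω j)
      + u (mark ω i) (mark ω j)) := by
  rw [conductance, if_neg h.ne', abs_sub_comm,
    abs_of_nonneg (sub_nonneg.2 (point_mono ω h.le))]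

/-- `W_k = exp ((1 - lam) Z_k - (1 + lam) Z_{k-1})`, the ratio up to constants of the conductances
from `k` to its left and to its right neighbour. -/
noncomputable def barrier (lam : ℝ) (ω : Environment) (k : ℤ) : ℝ :=
  Real.exp ((1 - lam) * gap ω k - (1 + lam) * gap ω (k - 1))

theorem barrier_pos (lam : ℝ) (ω : Environment) (k : ℤ) : 0 < barrier lam ω k := Real.exp_pos _

/-- A lower bound for the chance that the walk, when it first passes `k`, lands on `k`, if the
gaps are at least `d` and the oscillation of `u` is at most `D`. -/
noncomputable def landing (D lam d : ℝ) : ℝ := Real.exp (-D) * (1 - Real.exp (-((1 - lam) * d)))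

theorem landing_pos {D lam d : ℝ} (hd : 0 < d) (h1 : lam < 1) : 0 < landing D lam d := by
  have : Real.exp (-((1 - lam) * d)) < 1 := by
    rw [Real.exp_lt_one_iff]; nlinarith
  exact mul_pos (Real.exp_pos _) (by linarith)

theorem landing_le_one {D lam d : ℝ} (hD : 0 ≤ D) : landing D lam d ≤ 1 := by
  have h1 : Real.exp (-D) ≤ 1 := by rw [Real.exp_le_one_iff]; linarith
  have h2 := Real.exp_pos (-((1 - lam) * d))
  have h3 := Real.exp_pos (-D)
  unfold landing
  nlinarith

theorem inv_landing (D lam d : ℝ) :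
    (landing D lam d)⁻¹ = Real.exp D * (1 - Real.exp (-((1 - lam) * d)))⁻¹ := by
  rw [landing, mul_inv, Real.exp_neg, inv_inv]

/-! ### Geometric decay of conductances and one-step estimates -/

section Bounds

variable {u : ℝ → ℝ → ℝ} {lam d D : ℝ} {ω : Environment}

theorem conductance_add_le (hu : ∀ a b a' b', u a b ≤ u a' b' + D) (hω : ∀ k, d ≤ gap ω k)
    (h1 : lam < 1) {z k : ℤ} (hz : z < k) (n : ℕ) :
    conductance u lam ω z (k + n) ≤
      conductance u lam ω z k * Real.exp D * Real.exp (-((1 - lam) * d)) ^ n := by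
  rw [conductance_of_lt u lam ω hz, conductance_of_lt u lam ω (by omega : z < k + n),
    ← Real.exp_nat_mul, ← Real.exp_add, ← Real.exp_add, Real.exp_le_exp]
  have h2 := hu (mark ω z) (mark ω (k + n)) (mark ω z) (mark ω k)
  have h3 := le_point_sub hω k n
  nlinarith

/-- To the left the decay rate is `1 + lam`; it is weakened to `1 - lam` so that both directions
share one geometric ratio. -/
theorem conductance_sub_le (hu : ∀ a b a' b', u a b ≤ u a' b' + D) (hω : ∀ k, d ≤ gap ω k)
    (hd : 0 < d) (h0 : 0 < lam) {z k : ℤ} (hz : k < z) (n : ℕ) :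
    conductance u lam ω z (k - n) ≤
      conductance u lam ω z k * Real.exp D * Real.exp (-((1 - lam) * d)) ^ n := by
  rw [conductance_of_gt u lam ω hz, conductance_of_gt u lam ω (by omega : k - n < z),
    ← Real.exp_nat_mul, ← Real.exp_add, ← Real.exp_add, Real.exp_le_exp]
  have h2 := hu (mark ω z) (mark ω (k - n)) (mark ω z) (mark ω k)
  have h3 := le_point_sub hω (k - n) n
  rw [sub_add_cancel] at h3
  have h4 : 0 ≤ lam * (n * d) := by positivity
  nlinarith

theorem tsum_ofReal_le_of_geometric {f : ℕ → ℝ} {c : ℝ} (hd : 0 < d) (h1 : lam < 1)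
    (hc : 0 ≤ c) (hf : ∀ n, f n ≤ c * Real.exp D * Real.exp (-((1 - lam) * d)) ^ n) :
    ∑' n, ENNReal.ofReal (f n) ≤ ENNReal.ofReal (landing D lam d)⁻¹ * ENNReal.ofReal c := by
  have hr : Real.exp (-((1 - lam) * d)) < 1 := by
    rw [Real.exp_lt_one_iff]; nlinarith
  calc ∑' n, ENNReal.ofReal (f n)
      ≤ ∑' n, ENNReal.ofReal (c * Real.exp D * Real.exp (-((1 - lam) * d)) ^ n) :=
        ENNReal.tsum_le_tsum fun n => ENNReal.ofReal_le_ofReal (hf n)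
    _ = ENNReal.ofReal (∑' n : ℕ, c * Real.exp D * Real.exp (-((1 - lam) * d)) ^ n) :=
        (ENNReal.ofReal_tsum_of_nonneg (fun n => by positivity)
          ((summable_geometric_of_lt_one (Real.exp_pos _).le hr).mul_left _)).symm
    _ = ENNReal.ofReal (landing D lam d)⁻¹ * ENNReal.ofReal c := by
        rw [tsum_mul_left, tsum_geometric_of_lt_one (Real.exp_pos _).le hr,
          ← ENNReal.ofReal_mul (inv_nonneg.2 (landing_pos hd h1).le), inv_landing]
        congr 1; ring

theorem tsum_conductance_add_le (hu : ∀ a b a' b', u a b ≤ u a' b' + D)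
    (hω : ∀ k, d ≤ gap ω k) (hd : 0 < d) (h1 : lam < 1) {z k : ℤ} (hz : z < k) :
    ∑' n : ℕ, ENNReal.ofReal (conductance u lam ω z (k + n)) ≤
      ENNReal.ofReal (landing D lam d)⁻¹ * ENNReal.ofReal (conductance u lam ω z k) :=
  tsum_ofReal_le_of_geometric hd h1 (conductance_nonneg u lam ω z k)
    (conductance_add_le hu hω h1 hz)

theorem tsum_conductance_sub_le (hu : ∀ a b a' b', u a b ≤ u a' b' + D)
    (hω : ∀ k, d ≤ gap ω k) (hd : 0 < d) (h0 : 0 < lam) (h1 : lam < 1) {z k : ℤ} (hz : k < z) :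
    ∑' n : ℕ, ENNReal.ofReal (conductance u lam ω z (k - n)) ≤
      ENNReal.ofReal (landing D lam d)⁻¹ * ENNReal.ofReal (conductance u lam ω z k) :=
  tsum_ofReal_le_of_geometric hd h1 (conductance_nonneg u lam ω z k)
    (conductance_sub_le hu hω hd h0 hz)

theorem tsum_indicator_Ici (f : ℤ → ℝ≥0∞) (k : ℤ) :
    ∑' j, (Set.Ici k).indicator f j = ∑' n : ℕ, f (k + n) := by
  have hinj : Function.Injective fun n : ℕ => k + (n : ℤ) := fun a b h => by simpa using h
  rw [← hinj.tsum_eq]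
  · exact tsum_congr fun n => Set.indicator_of_mem (by simp) f
  · intro j hj
    have hk : k ≤ j := by
      by_contra h
      exact hj (Set.indicator_of_notMem (by simpa using h) f)
    exact ⟨(j - k).toNat, by simp only; omega⟩

theorem tsum_indicator_Iic (f : ℤ → ℝ≥0∞) (k : ℤ) :
    ∑' j, (Set.Iic k).indicator f j = ∑' n : ℕ, f (k - n) := by
  have hinj : Function.Injective fun n : ℕ => k - (n : ℤ) := fun a b h => by simpa using h
  rw [← hinj.tsum_eq]
  · exact tsum_congr fun n => Set.indicator_of_mem (by simp) f
  · intro j hj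
    have hk : j ≤ k := by
      by_contra h
      exact hj (Set.indicator_of_notMem (by simpa using h) f)
    exact ⟨(k - j).toNat, by simp only; omega⟩

variable (u lam ω) in
/-- The total conductance at `i`, an invariant measure of the walk. -/
noncomputable def totalConductance (i : ℤ) : ℝ≥0∞ := ∑' j, ENNReal.ofReal (conductance u lam ω i j)

theorem totalConductance_ne_zero (i : ℤ) : totalConductance u lam ω i ≠ 0 :=
  tsum_conductance_ne_zero u lam ω i

theorem totalConductance_le (hu : ∀ a b a' b', u a b ≤ u a' b' + D) (hω : ∀ k, d ≤ gap ω k)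
    (hd : 0 < d) (h0 : 0 < lam) (h1 : lam < 1) (z : ℤ) :
    totalConductance u lam ω z ≤ ENNReal.ofReal (landing D lam d)⁻¹ *
      (ENNReal.ofReal (conductance u lam ω z (z + 1)) +
        ENNReal.ofReal (conductance u lam ω z (z - 1))) := by
  let f : ℤ → ℝ≥0∞ := fun j => ENNReal.ofReal (conductance u lam ω z j)
  calc totalConductance u lam ω z
      ≤ ∑' j, ((Set.Ici (z + 1)).indicator f j + (Set.Iic (z - 1)).indicator f j) := by
        refine ENNReal.tsum_le_tsum fun j => ?_
        rcases lt_trichotomy z j with h | h | h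
        · refine le_add_right ?_
          rw [Set.indicator_of_mem (by simp only [Set.mem_Ici]; omega)]
        · simp [h, conductance]
        · refine le_add_left ?_
          rw [Set.indicator_of_mem (by simp only [Set.mem_Iic]; omega)]
    _ ≤ _ := by
        rw [ENNReal.tsum_add, tsum_indicator_Ici, tsum_indicator_Iic, mul_add]
        exact add_le_add (tsum_conductance_add_le hu hω hd h1 (by omega))
          (tsum_conductance_sub_le hu hω hd h0 h1 (by omega))

theorem totalConductance_ne_top (hu : ∀ a b a' b', u a b ≤ u a' b' + D)
    (hω : ∀ k, d ≤ gap ω k) (hd : 0 < d) (h0 : 0 < lam) (h1 : lam < 1) (z : ℤ) :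
    totalConductance u lam ω z ≠ ∞ :=
  ne_top_of_le_ne_top
    (ENNReal.mul_ne_top ENNReal.ofReal_ne_top
      (ENNReal.add_ne_top.2 ⟨ENNReal.ofReal_ne_top, ENNReal.ofReal_ne_top⟩))
    (totalConductance_le hu hω hd h0 h1 z)

theorem stepLaw_apply {z : ℤ} (h : totalConductance u lam ω z ≠ ∞) (j : ℤ) :
    stepLaw u lam ω z j =
      ENNReal.ofReal (conductance u lam ω z j) * (totalConductance u lam ω z)⁻¹ := by
  rw [totalConductance] at h ⊢
  rw [stepLaw, dif_pos h, PMF.normalize_apply]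

theorem stepKernel_Ici (z k : ℤ) :
    stepKernel u lam ω z (Set.Ici k) = ∑' n : ℕ, stepLaw u lam ω z (k + n) := by
  rw [← tsum_indicator_Ici]
  exact PMF.toMeasure_apply _ measurableSet_Ici

theorem stepKernel_singleton (z k : ℤ) : stepKernel u lam ω z {k} = stepLaw u lam ω z k :=
  PMF.toMeasure_apply_singleton _ _ (MeasurableSet.singleton _)

/-- The landing estimate: given a jump to `k` or beyond, the walk lands exactly on `k` with
probability at least `landing D lam d`, by the geometric decay of conductances beyond `k`. -/
theorem stepKernel_Ici_le (hu : ∀ a b a' b', u a b ≤ u a' b' + D) (hω : ∀ k, d ≤ gap ω k)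
    (hd : 0 < d) (h0 : 0 < lam) (h1 : lam < 1) {z k : ℤ} (hz : z < k) :
    stepKernel u lam ω z (Set.Ici k) ≤
      ENNReal.ofReal (landing D lam d)⁻¹ * stepKernel u lam ω z {k} := by
  have hfin := totalConductance_ne_top hu hω hd h0 h1 z
  simp only [stepKernel_Ici, stepKernel_singleton, stepLaw_apply hfin]
  rw [ENNReal.tsum_mul_right, ← mul_assoc]
  gcongr
  exact tsum_conductance_add_le hu hω hd h1 hz

theorem ofReal_conductance_add_le_totalConductance (z : ℤ) {j k : ℤ} (hjk : j ≠ k) :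
    ENNReal.ofReal (conductance u lam ω z j) + ENNReal.ofReal (conductance u lam ω z k) ≤
      totalConductance u lam ω z := by
  rw [← Finset.sum_pair (f := fun j => ENNReal.ofReal (conductance u lam ω z j)) hjk]
  exact ENNReal.sum_le_tsum _

/-- Domination of the conductance from `z ≤ m` to `m + 1` by the total conductance at `z`. -/
theorem conductance_mul_le (hu : ∀ a b a' b', u a b ≤ u a' b' + D) (h0 : 0 < lam) (h1 : lam < 1)
    {z m : ℤ} (hz : z ≤ m) :
    ENNReal.ofReal (conductance u lam ω z (m + 1)) * ENNReal.ofReal (1 + barrier lam ω m) ≤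
      ENNReal.ofReal (2 * Real.exp D) * totalConductance u lam ω z := by
  have hD : 1 ≤ Real.exp D := Real.one_le_exp (by linarith [hu 0 0 0 0])
  have hb := barrier_pos lam ω m
  have hm := point_succ ω m
  rw [← ENNReal.ofReal_mul (conductance_nonneg u lam ω _ _)]
  rcases hz.lt_or_eq with h | rfl
  -- From `z < m`, stopping at `m` instead of `m + 1` gains the factor `exp ((1 - lam) Z_m)`, up to
  -- `exp D`; this factor dominates both `1` and `W_m`, hence the `2`.
  · refine le_trans ?_ (mul_le_mul_right (ENNReal.le_tsum m) _)
    rw [← ENNReal.ofReal_mul (by positivity)]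
    refine ENNReal.ofReal_le_ofReal ?_
    have hb1 : barrier lam ω m ≤ Real.exp ((1 - lam) * gap ω m) := by
      refine Real.exp_le_exp.2 ?_
      nlinarith [gap_pos ω (m - 1)]
    have hb2 : 1 ≤ Real.exp ((1 - lam) * gap ω m) :=
      Real.one_le_exp (mul_nonneg (by linarith) (gap_pos ω m).le)
    have hc : conductance u lam ω z (m + 1) * Real.exp ((1 - lam) * gap ω m) ≤
        Real.exp D * conductance u lam ω z m := by
      rw [conductance_of_lt u lam ω h, conductance_of_lt u lam ω (by omega : z < m + 1),
        ← Real.exp_add, ← Real.exp_add, Real.exp_le_exp, hm]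
      linarith [hu (mark ω z) (mark ω (m + 1)) (mark ω z) (mark ω m)]
    have hc0 := conductance_nonneg u lam ω z (m + 1)
    nlinarith
  -- From `z = m` there is no such intermediate site; the competitor is the jump to `m - 1`, whose
  -- conductance is about `W_m` times that to `m + 1`.
  · refine le_trans ?_ (mul_le_mul_right
      (ofReal_conductance_add_le_totalConductance z (by omega : z + 1 ≠ z - 1)) _)
    rw [← ENNReal.ofReal_add (conductance_nonneg _ _ _ _ _) (conductance_nonneg _ _ _ _ _),
      ← ENNReal.ofReal_mul (by positivity)]
    refine ENNReal.ofReal_le_ofReal ?_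
    have hc : conductance u lam ω z (z + 1) * barrier lam ω z ≤
        Real.exp D * conductance u lam ω z (z - 1) := by
      have hm' := point_succ ω (z - 1)
      rw [sub_add_cancel] at hm'
      rw [conductance_of_lt u lam ω (by omega : z < z + 1),
        conductance_of_gt u lam ω (by omega : z - 1 < z), barrier,
        ← Real.exp_add, ← Real.exp_add, Real.exp_le_exp, hm, hm']
      linarith [hu (mark ω z) (mark ω (z + 1)) (mark ω z) (mark ω (z - 1))]
    have hc0 := conductance_nonneg u lam ω z (z + 1)
    have hc1 := conductance_nonneg u lam ω z (z - 1)
    nlinarith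

/-- From any site `z ≤ m` the walk passes `m` in one step with probability at most of order
`1 / (1 + W_m)`. -/
theorem stepKernel_Ici_succ_le (hu : ∀ a b a' b', u a b ≤ u a' b' + D) (hω : ∀ k, d ≤ gap ω k)
    (hd : 0 < d) (h0 : 0 < lam) (h1 : lam < 1) {z m : ℤ} (hz : z ≤ m) :
    stepKernel u lam ω z (Set.Ici (m + 1)) ≤
      ENNReal.ofReal ((landing D lam d)⁻¹ * (2 * Real.exp D) / (1 + barrier lam ω m)) := by
  have hfin := totalConductance_ne_top hu hω hd h0 h1 z
  have hb : 0 < 1 + barrier lam ω m := by linarith [barrier_pos lam ω m]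
  have hl := landing_pos (D := D) hd h1
  refine (stepKernel_Ici_le hu hω hd h0 h1 (by omega)).trans ?_
  rw [stepKernel_singleton, stepLaw_apply hfin, mul_div_assoc,
    ENNReal.ofReal_mul (inv_nonneg.2 hl.le)]
  gcongr
  have hB : ENNReal.ofReal (1 + barrier lam ω m) ≠ 0 := by simpa using hb
  rw [ENNReal.ofReal_div_of_pos hb, ← div_eq_mul_inv,
    ENNReal.div_le_iff (totalConductance_ne_zero z) hfin, mul_comm, mul_div_assoc',
    ENNReal.le_div_iff_mul_le (Or.inl hB) (Or.inl ENNReal.ofReal_ne_top),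
    mul_comm (totalConductance u lam ω z)]
  exact conductance_mul_le hu h0 h1 hz

/-- From `m` the walk passes `m` in one step with probability at least of order `1 / (1 + W_m)`. -/
theorem le_stepKernel_Ici_succ (hu : ∀ a b a' b', u a b ≤ u a' b' + D) (hω : ∀ k, d ≤ gap ω k)
    (hd : 0 < d) (h0 : 0 < lam) (h1 : lam < 1) (m : ℤ) :
    ENNReal.ofReal ((landing D lam d)⁻¹ * Real.exp D * (1 + barrier lam ω m))⁻¹ ≤
      stepKernel u lam ω m (Set.Ici (m + 1)) := by
  have hfin := totalConductance_ne_top hu hω hd h0 h1 m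
  have hD : 1 ≤ Real.exp D := Real.one_le_exp (by linarith [hu 0 0 0 0])
  have hb := barrier_pos lam ω m
  have hl := landing_pos (D := D) hd h1
  refine le_trans ?_ (measure_mono (Set.singleton_subset_iff.2 Set.self_mem_Ici))
  rw [stepKernel_singleton, stepLaw_apply hfin, ← div_eq_mul_inv,
    ENNReal.le_div_iff_mul_le (Or.inl (totalConductance_ne_zero m)) (Or.inl hfin),
    ENNReal.ofReal_inv_of_pos (by positivity), mul_comm, ← div_eq_mul_inv]
  refine ENNReal.div_le_of_le_mul' ((totalConductance_le hu hω hd h0 h1 m).trans ?_)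
  rw [← ENNReal.ofReal_add (conductance_nonneg _ _ _ _ _) (conductance_nonneg _ _ _ _ _),
    mul_assoc, ENNReal.ofReal_mul (inv_nonneg.2 hl.le), mul_assoc]
  gcongr
  rw [← ENNReal.ofReal_mul (by positivity)]
  refine ENNReal.ofReal_le_ofReal ?_
  have hc : conductance u lam ω m (m - 1) ≤
      Real.exp D * barrier lam ω m * conductance u lam ω m (m + 1) := by
    have hm := point_succ ω m
    have hm' := point_succ ω (m - 1)
    rw [sub_add_cancel] at hm'
    rw [conductance_of_lt u lam ω (by omega : m < m + 1),
      conductance_of_gt u lam ω (by omega : m - 1 < m), barrier,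
      ← Real.exp_add, ← Real.exp_add, Real.exp_le_exp, hm, hm']
    linarith [hu (mark ω m) (mark ω (m - 1)) (mark ω m) (mark ω (m + 1))]
  have hc0 := conductance_nonneg u lam ω m (m + 1)
  nlinarith

theorem totalConductance_le_exp (hu : ∀ a b a' b', u a b ≤ u a' b' + D)
    (hω : ∀ k, d ≤ gap ω k) (hd : 0 < d) (h0 : 0 < lam) (h1 : lam < 1) (z : ℤ) :
    totalConductance u lam ω z ≤ ENNReal.ofReal ((landing D lam d)⁻¹ *
      (2 * Real.exp (u 0 0 + D)) * Real.exp (2 * lam * point ω z)) := by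
  have hl := landing_pos (D := D) hd h1
  refine (totalConductance_le hu hω hd h0 h1 z).trans ?_
  rw [← ENNReal.ofReal_add (conductance_nonneg _ _ _ _ _) (conductance_nonneg _ _ _ _ _),
    mul_assoc, ENNReal.ofReal_mul (inv_nonneg.2 hl.le)]
  gcongr
  have hm := point_succ ω z
  have hm' := point_succ ω (z - 1)
  rw [sub_add_cancel] at hm'
  have e1 : conductance u lam ω z (z + 1) ≤
      Real.exp (u 0 0 + D) * Real.exp (2 * lam * point ω z) := by
    rw [conductance_of_lt u lam ω (by omega : z < z + 1), ← Real.exp_add, Real.exp_le_exp, hm]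
    nlinarith [hu (mark ω z) (mark ω (z + 1)) 0 0, gap_pos ω z]
  have e2 : conductance u lam ω z (z - 1) ≤
      Real.exp (u 0 0 + D) * Real.exp (2 * lam * point ω z) := by
    rw [conductance_of_gt u lam ω (by omega : z - 1 < z), ← Real.exp_add, Real.exp_le_exp, hm']
    nlinarith [hu (mark ω z) (mark ω (z - 1)) 0 0, gap_pos ω (z - 1)]
  linarith

end Bounds

end MottWalk

/-- Borel–Cantelli, in the form used for both the lower and the upper speed bound. -/
theorem ae_eventually_notMem_of_le_exp {α : Type*} [MeasurableSpace α] {μ : Measure α}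
    {s : ℕ → Set α} {b C : ℝ} (hb : 0 < b)
    (h : ∀ᶠ n : ℕ in atTop, μ (s n) ≤ ENNReal.ofReal (C * Real.exp (-(b * n)))) :
    ∀ᵐ x ∂μ, ∀ᶠ n in atTop, x ∉ s n := by
  obtain ⟨n₀, hn₀⟩ := eventually_atTop.1 h
  have hsum : Summable fun n : ℕ => C * Real.exp (-(b * n)) := by
    refine Summable.mul_left _ ?_
    have h1 : ∀ n : ℕ, Real.exp (-(b * n)) = Real.exp (-b) ^ n := fun n => by
      rw [← Real.exp_nat_mul]; congr 1; ring
    simp only [h1]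
    exact summable_geometric_of_lt_one (Real.exp_pos _).le (by rw [Real.exp_lt_one_iff]; linarith)
  have hfin : ∑' n, μ (s (n + n₀)) ≠ ∞ := by
    refine ne_top_of_le_ne_top ((summable_nat_add_iff n₀).2 hsum).tsum_ofReal_ne_top ?_
    exact ENNReal.tsum_le_tsum fun n => hn₀ _ (by omega)
  filter_upwards [ae_eventually_notMem hfin] with x hx
  obtain ⟨n₁, hn₁⟩ := eventually_atTop.1 hx
  refine eventually_atTop.2 ⟨n₁ + n₀, fun n hn => ?_⟩
  have := hn₁ (n - n₀) (by omega)
  rwa [Nat.sub_add_cancel (by omega)] at this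

namespace MottWalk

/-! ### No negative speed, by reversibility -/

section Lower

variable {u : ℝ → ℝ → ℝ} {lam d D : ℝ} {ω : Environment}

/-- The total conductance is an invariant measure of the walk, whence a bound on its marginals. -/
theorem walkLaw_mul_totalConductance_le (hu_symm : ∀ a b, u a b = u b a)
    (hfin : ∀ z, totalConductance u lam ω z ≠ ∞) (i j : ℤ) (n : ℕ) :
    walkLaw u lam ω i {X | X n = j} * totalConductance u lam ω i ≤
      totalConductance u lam ω j := by
  induction n generalizing j with
  | zero =>
    by_cases hij : i = j
    · subst hij
      exact mul_le_of_le_one_left' prob_le_one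
    · have hnull : walkLaw u lam ω i {X | X 0 = j} = 0 := by
        have h : ∀ᵐ X ∂walkLaw u lam ω i, ¬ X 0 = j :=
          (ae_walkLaw_zero u lam ω i).mono fun X hX hj => hij (hX.symm.trans hj)
        simpa [ae_iff] using h
      rw [hnull]
      simp
  | succ n ih =>
    rw [walkLaw_succ_eq, ← ENNReal.tsum_mul_right]
    calc ∑' k, stepLaw u lam ω k j * walkLaw u lam ω i {X | X n = k} * totalConductance u lam ω i
        ≤ ∑' k, stepLaw u lam ω k j * totalConductance u lam ω k := by
          refine ENNReal.tsum_le_tsum fun k => ?_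
          rw [mul_assoc]
          gcongr
          exact ih k
      -- Detailed balance: `π(k)` times the probability of the step from `k` to `j` is `c_{k,j} =
      -- c_{j,k}`, and these sum over `k` to `π(j)`.
      _ = totalConductance u lam ω j := by
          refine tsum_congr fun k => ?_
          rw [stepLaw_apply (hfin k), mul_assoc,
            ENNReal.inv_mul_cancel (totalConductance_ne_zero k) (hfin k), mul_one,
            conductance_symm hu_symm]

theorem totalConductance_neg_le (hu : ∀ a b a' b', u a b ≤ u a' b' + D)
    (hω : ∀ k, d ≤ gap ω k) (hd : 0 < d) (h0 : 0 < lam) (h1 : lam < 1) (n : ℕ) :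
    totalConductance u lam ω (-n) ≤ ENNReal.ofReal ((landing D lam d)⁻¹ *
      (2 * Real.exp (u 0 0 + D)) * Real.exp (-(2 * lam * d)) ^ n) := by
  have hl := landing_pos (D := D) hd h1
  refine (totalConductance_le_exp hu hω hd h0 h1 _).trans (ENNReal.ofReal_le_ofReal ?_)
  gcongr
  rw [← Real.exp_nat_mul, Real.exp_le_exp]
  have h := le_point_sub hω (-n) n
  rw [neg_add_cancel, point_zero] at h
  nlinarith

/-- The walk does not move to the left at positive speed. -/
theorem ae_eventually_neg_mul_le (hu_symm : ∀ a b, u a b = u b a)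
    (hu : ∀ a b a' b', u a b ≤ u a' b' + D)
    (hω : ∀ k, d ≤ gap ω k) (hd : 0 < d) (h0 : 0 < lam) (h1 : lam < 1) {a : ℝ} (ha : 0 < a) :
    ∀ᵐ X ∂walkLaw u lam ω 0, ∀ᶠ n : ℕ in atTop, -(a * n) ≤ (X n : ℝ) := by
  have hfin := totalConductance_ne_top hu hω hd h0 h1
  have hl := landing_pos (D := D) hd h1
  set A := (landing D lam d)⁻¹ * (2 * Real.exp (u 0 0 + D)) with hA
  have hA0 : 0 ≤ A := by positivity
  set s := Real.exp (-(2 * lam * d)) with hs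
  have hs0 : 0 < s := Real.exp_pos _
  have hs1 : s < 1 := by rw [hs, Real.exp_lt_one_iff]; nlinarith [mul_pos h0 hd]
  have hmarg : ∀ (n : ℕ) (j : ℤ), walkLaw u lam ω 0 {X | X n = j} ≤
      totalConductance u lam ω j * (totalConductance u lam ω 0)⁻¹ := fun n j => by
    rw [← div_eq_mul_inv, ENNReal.le_div_iff_mul_le (Or.inl (totalConductance_ne_zero 0))
      (Or.inl (hfin 0))]
    exact walkLaw_mul_totalConductance_le hu_symm hfin 0 j n
  have htail : ∀ n N : ℕ, walkLaw u lam ω 0 {X | X n ≤ -N} ≤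
      ENNReal.ofReal (A * (1 - s)⁻¹ * (totalConductance u lam ω 0).toReal⁻¹ * s ^ N) := by
    intro n N
    calc walkLaw u lam ω 0 {X | X n ≤ -N}
        ≤ walkLaw u lam ω 0 (⋃ k : ℕ, {X | X n = -((N + k : ℕ) : ℤ)}) := by
          refine measure_mono fun X (hX : X n ≤ -N) => Set.mem_iUnion.2 ⟨(-N - X n).toNat, ?_⟩
          simp only [Set.mem_ofPred_eq]
          omega
      _ ≤ ∑' k : ℕ, walkLaw u lam ω 0 {X | X n = -((N + k : ℕ) : ℤ)} := measure_iUnion_le _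
      _ ≤ ∑' k : ℕ, ENNReal.ofReal (A * s ^ N * s ^ k) * (totalConductance u lam ω 0)⁻¹ := by
          refine ENNReal.tsum_le_tsum fun k => (hmarg n _).trans ?_
          gcongr
          rw [mul_assoc, ← pow_add]
          exact totalConductance_neg_le hu hω hd h0 h1 (N + k)
      _ = _ := by
          rw [ENNReal.tsum_mul_right, ← ENNReal.ofReal_tsum_of_nonneg (fun k => by positivity)
            ((summable_geometric_of_lt_one hs0.le hs1).mul_left _), tsum_mul_left,
            tsum_geometric_of_lt_one hs0.le hs1, ← ENNReal.ofReal_toReal (hfin 0),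
            ← ENNReal.ofReal_inv_of_pos
              (ENNReal.toReal_pos (totalConductance_ne_zero 0) (hfin 0)),
            ← ENNReal.ofReal_mul (mul_nonneg (by positivity)
              (inv_nonneg.2 (by linarith))), ENNReal.toReal_ofReal ENNReal.toReal_nonneg]
          congr 1
          ring
  -- The factor `exp (2 lam d) = s⁻¹` in `C` pays for replacing `⌊a n⌋` by `a n`.
  have hbc := ae_eventually_notMem_of_le_exp (μ := walkLaw u lam ω 0)
    (s := fun n : ℕ => {X : ℕ → ℤ | X n ≤ -(⌊a * n⌋₊ : ℤ)}) (b := 2 * lam * d * a)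
    (C := A * (1 - s)⁻¹ * (totalConductance u lam ω 0).toReal⁻¹ * Real.exp (2 * lam * d))
    (by positivity) (Eventually.of_forall fun n => (htail n _).trans
      (ENNReal.ofReal_le_ofReal ?_))
  · filter_upwards [hbc] with X hX
    filter_upwards [hX] with n hn
    simp only [not_le] at hn
    have h2 : (-(⌊a * n⌋₊ : ℤ) : ℝ) < X n := by exact_mod_cast hn
    have h3 := Nat.floor_le (by positivity : 0 ≤ a * n)
    push_cast at h2
    linarith
  · rw [mul_assoc _ (Real.exp _), ← Real.exp_add]
    have hnn : 0 ≤ A * (1 - s)⁻¹ * (totalConductance u lam ω 0).toReal⁻¹ :=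
      mul_nonneg (mul_nonneg hA0 (inv_nonneg.2 (by linarith)))
        (inv_nonneg.2 ENNReal.toReal_nonneg)
    refine mul_le_mul_of_nonneg_left ?_ hnn
    rw [hs, ← Real.exp_nat_mul, Real.exp_le_exp]
    have h3 := Nat.lt_floor_add_one (a * n)
    nlinarith [mul_pos (mul_pos two_pos h0) hd]

end Lower

/-! ### The discount supermartingale along the running maximum -/

/-- With `φ i` the discount earned while the walk is stuck behind a record at `i`, and `ε` the
chance of landing on `i`, the total discount from level `k` to level `N`. -/
noncomputable def levelDiscount (ε : ℝ) (φ : ℤ → ℝ) (N k : ℤ) : ℝ :=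
  ∏ i ∈ Finset.Ico k N, (1 - ε * (1 - φ i))

/-- The total discount until level `N` is reached, for a walk whose running maximum is `m`. -/
noncomputable def recordDiscount (ε : ℝ) (φ : ℤ → ℝ) (N m : ℤ) : ℝ :=
  if m < N then φ m * levelDiscount ε φ N (m + 1) else 1

section Discount

variable {ε : ℝ} {φ : ℤ → ℝ} {N : ℤ}

theorem levelDiscount_of_lt {k : ℤ} (h : k < N) :
    levelDiscount ε φ N k = (1 - ε * (1 - φ k)) * levelDiscount ε φ N (k + 1) := by
  have h1 : Finset.Ico k N = insert k (Finset.Ico (k + 1) N) := by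
    ext i; simp only [Finset.mem_Ico, Finset.mem_insert]; omega
  rw [levelDiscount, h1, Finset.prod_insert (by simp)]
  rfl

theorem recordDiscount_of_le {m : ℤ} (h : N ≤ m) : recordDiscount ε φ N m = 1 :=
  if_neg (not_lt.2 h)

theorem levelDiscount_self : levelDiscount ε φ N N = 1 := by simp [levelDiscount]

variable (hε0 : 0 ≤ ε) (hε1 : ε ≤ 1) (hφ0 : ∀ i, 0 ≤ φ i)
include hε0 hε1 hφ0

theorem levelDiscount_nonneg (k : ℤ) : 0 ≤ levelDiscount ε φ N k :=
  Finset.prod_nonneg fun i _ => by nlinarith [mul_nonneg hε0 (hφ0 i)]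

theorem recordDiscount_nonneg (m : ℤ) : 0 ≤ recordDiscount ε φ N m := by
  unfold recordDiscount
  split_ifs
  · exact mul_nonneg (hφ0 m) (levelDiscount_nonneg hε0 hε1 hφ0 _)
  · exact zero_le_one

variable (hφ1 : ∀ i, φ i ≤ 1)
include hφ1

theorem levelDiscount_le_one (k : ℤ) : levelDiscount ε φ N k ≤ 1 :=
  Finset.prod_le_one (fun i _ => by nlinarith [hφ0 i, hφ1 i])
    (fun i _ => by nlinarith [hφ0 i, hφ1 i])

theorem recordDiscount_le_one (m : ℤ) : recordDiscount ε φ N m ≤ 1 := by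
  unfold recordDiscount
  split_ifs
  · exact mul_le_one₀ (hφ1 m) (levelDiscount_nonneg hε0 hε1 hφ0 _)
      (levelDiscount_le_one hε0 hε1 hφ0 hφ1 _)
  · exact le_rfl

theorem recordDiscount_le_levelDiscount {m : ℤ} (h : m ≤ N) :
    recordDiscount ε φ N m ≤ levelDiscount ε φ N m := by
  rcases h.lt_or_eq with h | rfl
  · rw [recordDiscount, if_pos h, levelDiscount_of_lt h]
    refine mul_le_mul_of_nonneg_right ?_ (levelDiscount_nonneg hε0 hε1 hφ0 _)
    nlinarith [hφ0 m, hφ1 m]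
  · rw [recordDiscount, if_neg (lt_irrefl _), levelDiscount_self]

theorem integrable_recordDiscount_comp (ν : Measure ℤ) [IsFiniteMeasure ν] (f : ℤ → ℤ) :
    Integrable (fun j => recordDiscount ε φ N (f j)) ν :=
  Integrable.of_bound (measurable_of_countable _).aestronglyMeasurable 1 (ae_of_all _ fun j => by
    rw [Real.norm_of_nonneg (recordDiscount_nonneg hε0 hε1 hφ0 _)]
    exact recordDiscount_le_one hε0 hε1 hφ0 hφ1 _)

/-- Downward induction on the level, from `N`. A jump to `k` or beyond either lands on `k`, with
conditional probability at least `ε`, and then picks up `φ k`, or overshoots `k` without discount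
there; so level `k` contributes at most `1 - ε (1 - φ k)`. -/
theorem setIntegral_recordDiscount_le (ν : Measure ℤ) [IsFiniteMeasure ν] {m : ℤ}
    (hland : ∀ k, m < k → ε * ν.real (Set.Ici k) ≤ ν.real {k}) (n : ℕ) (hn : m < N - n) :
    ∫ j in Set.Ici (N - n), recordDiscount ε φ N j ∂ν ≤
      ν.real (Set.Ici (N - n)) * levelDiscount ε φ N (N - n) := by
  have hint : Integrable (recordDiscount ε φ N) ν :=
    integrable_recordDiscount_comp (N := N) hε0 hε1 hφ0 hφ1 ν id
  induction n with
  | zero =>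
    simp only [Nat.cast_zero, sub_zero, levelDiscount_self, mul_one]
    rw [setIntegral_congr_fun (g := fun _ => (1 : ℝ)) measurableSet_Ici
      (fun j (hj : N ≤ j) => recordDiscount_of_le hj)]
    simp
  | succ n ih =>
    set k : ℤ := N - (n + 1 : ℕ) with hk
    have hk1 : N - (n : ℤ) = k + 1 := by rw [hk]; push_cast; ring
    rw [hk1] at ih
    have hkN : k < N := by omega
    have hdisj : Disjoint ({k} : Set ℤ) (Set.Ici (k + 1)) := by simp
    have hunion : Set.Ici k = {k} ∪ Set.Ici (k + 1) := by
      ext j; simp only [Set.mem_Ici, Set.mem_union, Set.mem_singleton_iff]; omega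
    have hmeas : ν.real (Set.Ici k) = ν.real {k} + ν.real (Set.Ici (k + 1)) := by
      rw [hunion, measureReal_union hdisj measurableSet_Ici]
    have hl := hland k hn
    rw [hmeas] at hl ⊢
    rw [hunion, setIntegral_union hdisj measurableSet_Ici hint.integrableOn hint.integrableOn,
      integral_singleton, smul_eq_mul, levelDiscount_of_lt hkN, recordDiscount, if_pos hkN]
    have ih' := ih (by omega)
    have hH := levelDiscount_nonneg (N := N) hε0 hε1 hφ0 (k + 1)
    have key : ν.real {k} * φ k + ν.real (Set.Ici (k + 1)) ≤
        (ν.real {k} + ν.real (Set.Ici (k + 1))) * (1 - ε * (1 - φ k)) := by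
      nlinarith [hφ1 k]
    nlinarith [mul_le_mul_of_nonneg_right key hH]

end Discount

/-- One-step supermartingale bound for the discount. -/
theorem integral_recordDiscount_max_le {ε t : ℝ} {p : ℤ → ℝ} {N m : ℤ} (hε0 : 0 ≤ ε) (hε1 : ε ≤ 1)
    (ht : 0 < t) (hp : ∀ i, 0 < p i) (ν : Measure ℤ) [IsProbabilityMeasure ν]
    (hland : ∀ k, m < k → ε * ν.real (Set.Ici k) ≤ ν.real {k})
    (hesc : ν.real (Set.Ici (m + 1)) ≤ p m) :
    ∫ j, recordDiscount ε (fun i => p i / (t + p i)) N (max m j) ∂ν ≤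
      (1 + t) * recordDiscount ε (fun i => p i / (t + p i)) N m := by
  set φ : ℤ → ℝ := fun i => p i / (t + p i) with hφ
  have hφ0 : ∀ i, 0 ≤ φ i := fun i => by have := hp i; positivity
  have hφ1 : ∀ i, φ i ≤ 1 := fun i =>
    (div_le_one (by linarith [hp i])).2 (by linarith [hp i])
  rcases lt_or_ge m N with hm | hm
  -- The step either sets a new record, reaching `m + 1` or beyond, or leaves the running maximum at
  -- `m`.
  · rw [← integral_add_compl measurableSet_Ici (s := Set.Ici (m + 1))
      (integrable_recordDiscount_comp hε0 hε1 hφ0 hφ1 ν (max m)),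
      setIntegral_congr_fun (g := recordDiscount ε φ N) measurableSet_Ici
        (fun j (hj : m + 1 ≤ j) => by simp only [max_eq_right (by omega : m ≤ j)]),
      setIntegral_congr_fun (g := fun _ => recordDiscount ε φ N m) measurableSet_Ici.compl
        (fun j (hj : ¬ m + 1 ≤ j) => by simp only [max_eq_left (by omega : j ≤ m)]),
      setIntegral_const, probReal_compl_eq_one_sub measurableSet_Ici, smul_eq_mul]
    have h1 := setIntegral_recordDiscount_le (N := N) hε0 hε1 hφ0 hφ1 ν hland
      (N - (m + 1)).toNat (by omega)
    rw [show N - ((N - (m + 1)).toNat : ℤ) = m + 1 by omega] at h1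
    have hH := levelDiscount_nonneg (N := N) hε0 hε1 hφ0 (m + 1)
    have hg : recordDiscount ε φ N m = φ m * levelDiscount ε φ N (m + 1) := if_pos hm
    -- With `q ≤ p m` the chance of a new record, this says `q (1 - φ m) ≤ t φ m`; the choice of `φ`
    -- makes it an equality at `q = p m`.
    have key : ν.real (Set.Ici (m + 1)) + (1 - ν.real (Set.Ici (m + 1))) * φ m ≤
        (1 + t) * φ m := by
      have h2 : p m * (1 - φ m) = t * φ m := by
        have := hp m
        simp only [hφ]
        field_simp
        ring
      nlinarith [hφ1 m]
    rw [hg]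
    nlinarith [mul_le_mul_of_nonneg_right key hH]
  · have h1 : ∀ j, recordDiscount ε φ N (max m j) = 1 := fun j =>
      recordDiscount_of_le (hm.trans (le_max_left _ _))
    simp only [h1, integral_const, probReal_univ, smul_eq_mul, recordDiscount_of_le hm]
    linarith

/-- The running maximum is a functional of the path up to time `n`, as `lintegral_walkLaw_succ`
requires. -/
theorem partialSups_min_eq (X : ℕ → ℤ) (n : ℕ) :
    partialSups (fun k => X (min k n)) n = partialSups X n := by
  rw [partialSups_apply, partialSups_apply]
  exact Finset.sup'_congr _ rfl fun k hk => by rw [min_eq_left (Finset.mem_Iic.1 hk)]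

/-! ### Tail bound for the position at time `n` -/

section Walk

variable {u : ℝ → ℝ → ℝ} {lam ε t : ℝ} {ω : Environment} {p : ℤ → ℝ}

theorem lintegral_recordDiscount_le (hε0 : 0 ≤ ε) (hε1 : ε ≤ 1) (ht : 0 < t) (hp : ∀ i, 0 < p i)
    (hland : ∀ z k, z < k → ε * (stepKernel u lam ω z).real (Set.Ici k) ≤
      (stepKernel u lam ω z).real {k})
    (hesc : ∀ z m, z ≤ m → (stepKernel u lam ω z).real (Set.Ici (m + 1)) ≤ p m)
    (N : ℤ) (n : ℕ) :
    ∫⁻ X, ENNReal.ofReal (recordDiscount ε (fun i => p i / (t + p i)) N (partialSups X n))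
        ∂walkLaw u lam ω 0 ≤
      ENNReal.ofReal ((1 + t) ^ n * recordDiscount ε (fun i => p i / (t + p i)) N 0) := by
  have hφ0 : ∀ i, 0 ≤ p i / (t + p i) := fun i => by have := hp i; positivity
  have hφ1 : ∀ i, p i / (t + p i) ≤ 1 := fun i =>
    (div_le_one (by linarith [hp i])).2 (by linarith [hp i])
  induction n with
  | zero =>
    rw [lintegral_congr_ae ((ae_walkLaw_zero u lam ω 0).mono fun X hX => by
      rw [partialSups_zero, hX])]
    simp
  | succ n ih =>
    simp only [partialSups_add_one]
    rw [lintegral_walkLaw_succ u lam ω 0 n (fun X => partialSups X n)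
      (fun X => partialSups_min_eq X n)
      (fun m j => ENNReal.ofReal (recordDiscount ε (fun i => p i / (t + p i)) N (m ⊔ j)))]
    calc _ ≤ ∫⁻ X, ENNReal.ofReal (1 + t) * ENNReal.ofReal
            (recordDiscount ε (fun i => p i / (t + p i)) N (partialSups X n))
            ∂walkLaw u lam ω 0 := by
          refine lintegral_mono fun X => ?_
          have hX : X n ≤ partialSups X n := le_partialSups X n
          rw [← ENNReal.ofReal_mul (by positivity), ← ofReal_integral_eq_lintegral_ofReal
            (integrable_recordDiscount_comp hε0 hε1 hφ0 hφ1 _ _)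
            (ae_of_all _ fun j => recordDiscount_nonneg hε0 hε1 hφ0 _)]
          exact ENNReal.ofReal_le_ofReal (integral_recordDiscount_max_le hε0 hε1 ht hp _
            (fun k hk => hland _ k (hX.trans_lt hk)) (hesc _ _ hX))
      _ ≤ _ := by
          rw [lintegral_const_mul' _ _ ENNReal.ofReal_ne_top, pow_succ', mul_assoc,
            ENNReal.ofReal_mul (p := 1 + t) (by positivity)]
          gcongr

/-- The probability that the walk is beyond `N` at time `n`. -/
theorem walkLaw_ge_le (hε0 : 0 ≤ ε) (hε1 : ε ≤ 1) (ht : 0 < t) (hp : ∀ i, 0 < p i)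
    (hland : ∀ z k, z < k → ε * (stepKernel u lam ω z).real (Set.Ici k) ≤
      (stepKernel u lam ω z).real {k})
    (hesc : ∀ z m, z ≤ m → (stepKernel u lam ω z).real (Set.Ici (m + 1)) ≤ p m)
    (N n : ℕ) :
    walkLaw u lam ω 0 {X | (N : ℤ) ≤ X n} ≤
      ENNReal.ofReal (Real.exp (t * n - ε * t * ∑ i ∈ Finset.range N, (t + p i)⁻¹)) := by
  have hφ0 : ∀ i, 0 ≤ p i / (t + p i) := fun i => by have := hp i; positivity
  have hφ1 : ∀ i, p i / (t + p i) ≤ 1 := fun i =>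
    (div_le_one (by linarith [hp i])).2 (by linarith [hp i])
  have hmeas : MeasurableSet {X : ℕ → ℤ | (N : ℤ) ≤ X n} :=
    measurableSet_le measurable_const (measurable_pi_apply n)
  rw [← lintegral_indicator_one hmeas]
  refine le_trans (lintegral_mono fun X => ?_)
    ((lintegral_recordDiscount_le hε0 hε1 ht hp hland hesc N n).trans
      (ENNReal.ofReal_le_ofReal ?_))
  -- Markov's inequality: the discount is `1` once the running maximum has reached `N`.
  · by_cases hX : (N : ℤ) ≤ X n
    · rw [recordDiscount_of_le (hX.trans (le_partialSups X n))]
      exact (Set.indicator_le_self _ _ X).trans (by simp)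
    · rw [Set.indicator_of_notMem (show X ∉ {X : ℕ → ℤ | (N : ℤ) ≤ X n} from hX)]
      exact zero_le
  · have h1 : (1 + t) ^ n ≤ Real.exp (t * n) := by
      rw [mul_comm, Real.exp_nat_mul]
      exact pow_le_pow_left₀ (by positivity) (by linarith [Real.add_one_le_exp t]) n
    have h2 : levelDiscount ε (fun i => p i / (t + p i)) N 0 ≤
        Real.exp (-(ε * t * ∑ i ∈ Finset.range N, (t + p i)⁻¹)) := by
      have h3 : levelDiscount ε (fun i => p i / (t + p i)) N 0 =
          ∏ i ∈ Finset.range N, (1 - ε * (1 - p i / (t + p i))) := by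
        refine (Finset.prod_bij (fun (i : ℕ) _ => (i : ℤ)) ?_ ?_ ?_ ?_).symm
        · intro i hi; simpa using hi
        · intro i _ j _ h; simpa using h
        · intro j hj
          rw [Finset.mem_Ico] at hj
          exact ⟨j.toNat, by rw [Finset.mem_range]; omega, by omega⟩
        · intro i _; rfl
      rw [h3, Finset.mul_sum, ← Finset.sum_neg_distrib, Real.exp_sum]
      refine Finset.prod_le_prod (fun i _ => by nlinarith [hφ0 i, hφ1 i]) fun i _ => ?_
      have h4 : 1 - p i / (t + p i) = t * (t + p i)⁻¹ := by
        have := hp i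
        field_simp
        ring
      rw [h4]
      linarith [Real.add_one_le_exp (-(ε * t * (t + p i)⁻¹))]
    rw [sub_eq_add_neg, Real.exp_add]
    exact mul_le_mul h1 ((recordDiscount_le_levelDiscount hε0 hε1 hφ0 hφ1 (by simp)).trans h2)
      (recordDiscount_nonneg hε0 hε1 hφ0 _) (Real.exp_pos _).le

end Walk

/-! ### Stationarity of the environment -/

theorem iterate_shift_one (n : ℕ) (ω : Environment) : (shift 1)^[n] ω = shift n ω := by
  induction n with
  | zero => funext k; simp [shift]
  | succ n ih =>
    rw [Function.iterate_succ_apply', ih]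
    funext k
    simp only [shift]
    congr 1
    push_cast
    ring

theorem measurable_gap (k : ℤ) : Measurable fun ω : Environment => gap ω k :=
  measurable_subtype_coe.comp (measurable_fst.comp (measurable_pi_apply k))

theorem measurable_barrier (lam : ℝ) (k : ℤ) : Measurable fun ω => barrier lam ω k :=
  Real.measurable_exp.comp
    (((measurable_gap k).const_mul _).sub ((measurable_gap (k - 1)).const_mul _))

theorem barrier_shift (lam : ℝ) (ω : Environment) (k l : ℤ) :
    barrier lam (shift l ω) k = barrier lam ω (k + l) := by
  simp only [barrier, gap, shift]
  rw [show k - 1 + l = k + l - 1 by ring]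

theorem ae_forall_le_gap {P : Measure Environment} (hP : MeasurePreserving (shift 1) P P) {d : ℝ}
    (hd : ∀ᵐ ω ∂P, d ≤ gap ω 0) : ∀ᵐ ω ∂P, ∀ k, d ≤ gap ω k := by
  have hmeas : ∀ k, NullMeasurableSet {ω : Environment | d ≤ gap ω k}ᶜ P := fun k =>
    (measurableSet_le measurable_const (measurable_gap k)).compl.nullMeasurableSet
  have hshift : ∀ (k : ℤ) (n : ℕ),
      P {ω | d ≤ gap ω (k + n)}ᶜ = P {ω | d ≤ gap ω k}ᶜ := by
    intro k n
    rw [← (hP.iterate n).measure_preimage (hmeas k)]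
    congr 1
    ext ω
    simp only [Set.mem_compl_iff, Set.mem_preimage, iterate_shift_one]
    rfl
  refine ae_all_iff.2 fun k => ?_
  have h0 : P {ω | d ≤ gap ω 0}ᶜ = 0 := hd
  change P {ω | d ≤ gap ω k}ᶜ = 0
  -- Only forward shifts are iterated: for `k ≥ 0` one shifts from `0` to `k`, for `k ≤ 0` from `k`
  -- to `0`.
  rcases le_total 0 k with hk | hk
  · have := hshift 0 k.toNat
    rwa [zero_add, Int.toNat_of_nonneg hk, h0] at this
  · have := hshift k (-k).toNat
    rw [Int.toNat_of_nonneg (by omega), add_neg_cancel, h0] at this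
    exact this.symm

/-! ### Zero velocity when the barrier has infinite mean -/

section Velocity

variable {P : Measure Environment} {u : ℝ → ℝ → ℝ} {lam d D : ℝ}

/-- If `W_0` has infinite mean, the mean of `1 / (t + K / (1 + W_0))` is arbitrarily large for
suitable `t > 0`. -/
theorem exists_lt_integral_inv [IsProbabilityMeasure P] {K : ℝ} (hK : 0 < K)
    (hW : ∫⁻ ω, ENNReal.ofReal (barrier lam ω 0) ∂P = ∞) (L : ℝ) :
    ∃ t : ℝ, 0 < t ∧ L < ∫ ω, (t + K / (1 + barrier lam ω 0))⁻¹ ∂P := by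
  have hb := fun ω => barrier_pos lam ω 0
  have hK' : ∀ ω, 0 < K / (1 + barrier lam ω 0) := fun ω => div_pos hK (by linarith [hb ω])
  have hmeas : ∀ t : ℝ, Measurable fun ω => (t + K / (1 + barrier lam ω 0))⁻¹ := fun t =>
    (measurable_const.add (measurable_const.div
      (measurable_const.add (measurable_barrier lam 0)))).inv
  -- Monotone convergence as `t` decreases to `0`: the limit `(1 + W_0) / K` has infinite mean,
  -- while for each fixed `t > 0` the integrand is bounded by `1 / t`.
  let t : ℕ → ℝ := fun n => 1 / ((n : ℝ) + 1)
  have ht : ∀ n, 0 < t n := fun n => by positivity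
  have hlim := lintegral_tendsto_of_tendsto_of_monotone (μ := P)
    (f := fun n ω => ENNReal.ofReal (t n + K / (1 + barrier lam ω 0))⁻¹)
    (F := fun ω => ENNReal.ofReal (0 + K / (1 + barrier lam ω 0))⁻¹)
    (fun n => (hmeas _).ennreal_ofReal.aemeasurable)
    (ae_of_all _ fun ω m n hmn => ENNReal.ofReal_le_ofReal (inv_anti₀
      (add_pos (ht n) (hK' ω)) (by
        have : t n ≤ t m := one_div_le_one_div_of_le (by positivity) (by gcongr)
        linarith)))
    (ae_of_all _ fun ω => ENNReal.tendsto_ofReal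
      ((tendsto_one_div_add_atTop_nhds_zero_nat.add_const _).inv₀
        (by have := hK' ω; linarith)))
  have htop : ∫⁻ ω, ENNReal.ofReal (0 + K / (1 + barrier lam ω 0))⁻¹ ∂P = ∞ := by
    rw [eq_top_iff]
    calc ∞ = ENNReal.ofReal K⁻¹ * ∫⁻ ω, ENNReal.ofReal (barrier lam ω 0) ∂P := by
          rw [hW, ENNReal.mul_top (by simpa using hK)]
      _ = ∫⁻ ω, ENNReal.ofReal (K⁻¹ * barrier lam ω 0) ∂P := by
          rw [← lintegral_const_mul' _ _ ENNReal.ofReal_ne_top]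
          simp only [ENNReal.ofReal_mul (inv_nonneg.2 hK.le)]
      _ ≤ _ := by
          refine lintegral_mono fun ω => ENNReal.ofReal_le_ofReal ?_
          rw [zero_add, inv_div, div_eq_inv_mul]
          gcongr
          linarith
  rw [htop] at hlim
  obtain ⟨n, hn⟩ := (hlim.eventually (eventually_gt_nhds (ENNReal.ofReal_lt_top (r := L)))).exists
  have hnonneg : ∀ ω, 0 ≤ (t n + K / (1 + barrier lam ω 0))⁻¹ := fun ω =>
    inv_nonneg.2 (add_pos (ht n) (hK' ω)).le
  refine ⟨t n, ht n, ?_⟩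
  rw [← ofReal_integral_eq_lintegral_ofReal (Integrable.of_bound (hmeas _).aestronglyMeasurable
    (t n)⁻¹ (ae_of_all _ fun ω => ?_)) (ae_of_all _ hnonneg)] at hn
  · exact (ENNReal.ofReal_lt_ofReal_iff').1 hn |>.1
  · rw [Real.norm_of_nonneg (hnonneg ω)]
    exact inv_anti₀ (ht n) (by linarith [hK' ω])

theorem ae_ae_eventually_le_mul [IsProbabilityMeasure P] (hP : Ergodic (shift 1) P)
    (hu : ∀ a b a' b', u a b ≤ u a' b' + D) (hgap : ∀ᵐ ω ∂P, ∀ k, d ≤ gap ω k)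
    (hd : 0 < d) (h0 : 0 < lam) (h1 : lam < 1)
    (hW : ∫⁻ ω, ENNReal.ofReal (barrier lam ω 0) ∂P = ∞) {a : ℝ} (ha : 0 < a) :
    ∀ᵐ ω ∂P, ∀ᵐ X ∂walkLaw u lam ω 0, ∀ᶠ n : ℕ in atTop, (X n : ℝ) ≤ a * n := by
  set ε := landing D lam d with hε
  have hε0 : 0 < ε := landing_pos hd h1
  have hε1 : ε ≤ 1 := landing_le_one (by linarith [hu 0 0 0 0])
  set K := (landing D lam d)⁻¹ * (2 * Real.exp D) with hK
  have hK0 : 0 < K := by positivity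
  -- With `N` about `a n`, the mean `4 / (ε a)` turns the tail exponent into `t n - 4 t n = -3 t n`,
  -- up to a constant due to the floor.
  obtain ⟨t, ht, hL⟩ := exists_lt_integral_inv hK0 hW (4 / (ε * a))
  have hp0 : ∀ ω i, 0 < K / (1 + barrier lam ω i) := fun ω i =>
    div_pos hK0 (by linarith [barrier_pos lam ω i])
  have hmeas : Measurable fun ω => (t + K / (1 + barrier lam ω 0))⁻¹ :=
    (measurable_const.add (measurable_const.div
      (measurable_const.add (measurable_barrier lam 0)))).inv
  have hbound : ∀ ω, |(t + K / (1 + barrier lam ω 0))⁻¹| ≤ t⁻¹ := fun ω => by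
    have := hp0 ω 0
    rw [abs_of_nonneg (by positivity)]
    exact inv_anti₀ ht (by linarith)
  filter_upwards [hgap, hP.ae_eventually_le_birkhoffSum hmeas hbound hL] with ω hω hsum
  have htail := walkLaw_ge_le (u := u) (lam := lam) (ω := ω)
    (p := fun i => K / (1 + barrier lam ω i)) hε0.le hε1 ht (hp0 ω)
    (fun z k hz => by
      have h := ENNReal.toReal_mono (by finiteness) (stepKernel_Ici_le hu hω hd h0 h1 hz)
      rw [ENNReal.toReal_mul, ENNReal.toReal_ofReal (inv_nonneg.2 hε0.le)] at h
      rwa [← div_eq_inv_mul, le_div_iff₀ hε0, mul_comm] at h)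
    (fun z m hz => ENNReal.toReal_le_of_le_ofReal (hp0 ω m).le
      (stepKernel_Ici_succ_le hu hω hd h0 h1 hz))
  have hfloor : Tendsto (fun n : ℕ => ⌊a * n⌋₊) atTop atTop :=
    tendsto_nat_floor_atTop.comp (tendsto_natCast_atTop_atTop.const_mul_atTop ha)
  have hbc := ae_eventually_notMem_of_le_exp (μ := walkLaw u lam ω 0)
    (s := fun n : ℕ => {X : ℕ → ℤ | ((⌊a * n⌋₊ : ℕ) : ℤ) ≤ X n}) (b := 3 * t)
    (C := Real.exp (ε * t * (4 / (ε * a)))) (by positivity) (by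
      filter_upwards [hfloor.eventually hsum] with n hn
      refine (htail _ n).trans (ENNReal.ofReal_le_ofReal ?_)
      rw [← Real.exp_add, Real.exp_le_exp]
      have h2 : birkhoffSum (shift 1) (fun ω => (t + K / (1 + barrier lam ω 0))⁻¹) ⌊a * n⌋₊ ω =
          ∑ i ∈ Finset.range ⌊a * n⌋₊, (t + K / (1 + barrier lam ω i))⁻¹ := by
        simp only [birkhoffSum, iterate_shift_one, barrier_shift, zero_add]
      rw [h2] at hn
      have h3 : a * n - 1 ≤ (⌊a * n⌋₊ : ℝ) := by linarith [Nat.lt_floor_add_one (a * n)]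
      have h4 : 4 / (ε * a) * (a * n - 1) ≤ 4 / (ε * a) * (⌊a * n⌋₊ : ℝ) := by gcongr
      have h5 : ε * t * (4 / (ε * a) * (a * n - 1)) ≤
          ε * t * ∑ i ∈ Finset.range ⌊a * n⌋₊, (t + K / (1 + barrier lam ω i))⁻¹ := by
        gcongr
        exact h4.trans hn
      have h6 : ε * t * (4 / (ε * a) * (a * n - 1)) =
          4 * t * n - ε * t * (4 / (ε * a)) := by
        field_simp
      linarith)
  filter_upwards [hbc] with X hX
  filter_upwards [hX] with n hn
  have h2 : X n < ((⌊a * n⌋₊ : ℕ) : ℤ) := not_le.1 hn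
  have h3 : (X n : ℝ) < (⌊a * n⌋₊ : ℝ) := by exact_mod_cast h2
  linarith [Nat.floor_le (by positivity : 0 ≤ a * n)]

/-- Both speed bounds are taken along `a = 1 / (m + 1)`, so that countably many null sets suffice.
-/
theorem hasVelocity_zero [IsProbabilityMeasure P] (hP : Ergodic (shift 1) P)
    (hu_symm : ∀ a b, u a b = u b a)
    (hu : ∀ a b a' b', u a b ≤ u a' b' + D) (hgap : ∀ᵐ ω ∂P, ∀ k, d ≤ gap ω k)
    (hd : 0 < d) (h0 : 0 < lam) (h1 : lam < 1)
    (hW : ∫⁻ ω, ENNReal.ofReal (barrier lam ω 0) ∂P = ∞) : HasVelocity P u lam 0 := by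
  have hup : ∀ᵐ ω ∂P, ∀ m : ℕ, ∀ᵐ X ∂walkLaw u lam ω 0, ∀ᶠ n : ℕ in atTop,
      (X n : ℝ) ≤ 1 / ((m : ℝ) + 1) * n :=
    ae_all_iff.2 fun m => ae_ae_eventually_le_mul hP hu hgap hd h0 h1 hW (by positivity)
  filter_upwards [hup, hgap] with ω hω hωgap
  have hlow : ∀ᵐ X ∂walkLaw u lam ω 0, ∀ m : ℕ, ∀ᶠ n : ℕ in atTop,
      -(1 / ((m : ℝ) + 1) * n) ≤ (X n : ℝ) :=
    ae_all_iff.2 fun m => ae_eventually_neg_mul_le hu_symm hu hωgap hd h0 h1 (by positivity)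
  filter_upwards [ae_all_iff.2 hω, hlow] with X hX₁ hX₂
  rw [Metric.tendsto_nhds]
  intro e he
  obtain ⟨m, hm⟩ := exists_nat_one_div_lt he
  filter_upwards [hX₁ m, hX₂ m, eventually_gt_atTop 0] with n h2 h3 hn
  have hn' : (0 : ℝ) < n := by exact_mod_cast hn
  rw [Real.dist_eq, sub_zero, abs_div, abs_of_pos hn', div_lt_iff₀ hn']
  exact (abs_le.2 ⟨h3, h2⟩).trans_lt (by gcongr)

end Velocity

/-! ### Comparison of the crossing probability with the barrier -/

section Equivalence

variable {u : ℝ → ℝ → ℝ} {lam d D : ℝ} {ω : Environment}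

variable (u lam ω) in
/-- The largest one-step probability of passing the origin from its left. -/
noncomputable def crossing : ℝ≥0∞ :=
  ⨆ z : ℤ, ⨆ _ : z ≤ 0, walkLaw u lam ω z {X : ℕ → ℤ | 1 ≤ X 1}

theorem crossing_le (hu : ∀ a b a' b', u a b ≤ u a' b' + D) (hω : ∀ k, d ≤ gap ω k)
    (hd : 0 < d) (h0 : 0 < lam) (h1 : lam < 1) :
    crossing u lam ω ≤
      ENNReal.ofReal ((landing D lam d)⁻¹ * (2 * Real.exp D) / (1 + barrier lam ω 0)) :=
  iSup₂_le fun z hz => (walkLaw_one u lam ω z (Set.Ici 1)).trans_le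
    (by simpa using stepKernel_Ici_succ_le hu hω hd h0 h1 hz)

/-- The supremum is bounded below by its value at the origin alone. -/
theorem le_crossing (hu : ∀ a b a' b', u a b ≤ u a' b' + D) (hω : ∀ k, d ≤ gap ω k)
    (hd : 0 < d) (h0 : 0 < lam) (h1 : lam < 1) :
    ENNReal.ofReal ((landing D lam d)⁻¹ * Real.exp D * (1 + barrier lam ω 0))⁻¹ ≤
      crossing u lam ω :=
  (le_stepKernel_Ici_succ hu hω hd h0 h1 0).trans
    ((walkLaw_one u lam ω 0 (Set.Ici (0 + 1))).symm.le.trans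
      (le_iSup₂_of_le (f := fun (z : ℤ) (_ : z ≤ 0) => walkLaw u lam ω z {X : ℕ → ℤ | 1 ≤ X 1})
        0 le_rfl le_rfl))

theorem lintegral_inv_crossing_eq_top_iff {P : Measure Environment} [IsProbabilityMeasure P]
    (hu : ∀ a b a' b', u a b ≤ u a' b' + D) (hgap : ∀ᵐ ω ∂P, ∀ k, d ≤ gap ω k)
    (hd : 0 < d) (h0 : 0 < lam) (h1 : lam < 1) :
    ∫⁻ ω, (crossing u lam ω)⁻¹ ∂P = ∞ ↔ ∫⁻ ω, ENNReal.ofReal (barrier lam ω 0) ∂P = ∞ := by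
  have hl := landing_pos (D := D) hd h1
  constructor
  · intro h
    have h2 : ∫⁻ ω, (crossing u lam ω)⁻¹ ∂P ≤
        ENNReal.ofReal ((landing D lam d)⁻¹ * Real.exp D) *
          (1 + ∫⁻ ω, ENNReal.ofReal (barrier lam ω 0) ∂P) := by
      calc ∫⁻ ω, (crossing u lam ω)⁻¹ ∂P
          ≤ ∫⁻ ω, ENNReal.ofReal ((landing D lam d)⁻¹ * Real.exp D) *
              (1 + ENNReal.ofReal (barrier lam ω 0)) ∂P := by
            refine lintegral_mono_ae ?_
            filter_upwards [hgap] with ω hω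
            have hb := barrier_pos lam ω 0
            rw [← ENNReal.ofReal_one, ← ENNReal.ofReal_add zero_le_one hb.le,
              ← ENNReal.ofReal_mul (by positivity), ENNReal.inv_le_iff_inv_le,
              ← ENNReal.ofReal_inv_of_pos (by positivity)]
            exact le_crossing hu hω hd h0 h1
        _ = _ := by
            rw [lintegral_const_mul' _ _ ENNReal.ofReal_ne_top,
              lintegral_add_left measurable_const]
            simp
    by_contra hne
    rw [h, top_le_iff] at h2
    exact absurd h2 (ENNReal.mul_ne_top ENNReal.ofReal_ne_top
      (ENNReal.add_ne_top.2 ⟨ENNReal.one_ne_top, hne⟩))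
  · intro h
    have h2 : ∫⁻ ω, ENNReal.ofReal (barrier lam ω 0) ∂P ≤
        ENNReal.ofReal ((landing D lam d)⁻¹ * (2 * Real.exp D)) *
          ∫⁻ ω, (crossing u lam ω)⁻¹ ∂P := by
      rw [← lintegral_const_mul' _ _ ENNReal.ofReal_ne_top]
      refine lintegral_mono_ae ?_
      filter_upwards [hgap] with ω hω
      have hb := barrier_pos lam ω 0
      have h3 := ENNReal.inv_le_inv.2 (crossing_le hu hω hd h0 h1)
      rw [← ENNReal.ofReal_inv_of_pos (by positivity)] at h3
      refine le_trans ?_ (mul_le_mul_right h3 _)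
      rw [← ENNReal.ofReal_mul (by positivity)]
      refine ENNReal.ofReal_le_ofReal ?_
      rw [inv_div, mul_div_cancel₀ _ (by positivity)]
      linarith
    by_contra hne
    rw [h, top_le_iff] at h2
    exact absurd h2 (ENNReal.mul_ne_top ENNReal.ofReal_ne_top hne)

end Equivalence

end MottWalk

theorem mainTheorem3 (P : Measure MottWalk.Environment) [IsProbabilityMeasure P]
    (hP : MottWalk.IsAdmissible P)
    (u : ℝ → ℝ → ℝ) (hu_meas : Measurable (Function.uncurry u))
    (hu_symm : ∀ a b, u a b = u b a)
    (hu_bdd : ∃ umin umax : ℝ, ∀ a b, umin ≤ u a b ∧ u a b ≤ umax)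
    (lam : ℝ) (hlam_pos : 0 < lam) (hlam_lt : lam < 1) :
    ((∫⁻ ω, (⨆ z : ℤ, ⨆ _ : z ≤ 0,
          MottWalk.walkLaw u lam ω z {X : ℕ → ℤ | 1 ≤ X 1})⁻¹ ∂P = ∞) →
        MottWalk.HasVelocity P u lam 0) ∧
      ((∫⁻ ω, (⨆ z : ℤ, ⨆ _ : z ≤ 0,
          MottWalk.walkLaw u lam ω z {X : ℕ → ℤ | 1 ≤ X 1})⁻¹ ∂P = ∞) ↔
        ∫⁻ ω, ENNReal.ofReal (Real.exp
          ((1 - lam) * MottWalk.gap ω 0 - (1 + lam) * MottWalk.gap ω (-1))) ∂P = ∞) := by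
  obtain ⟨umin, umax, hub⟩ := hu_bdd
  obtain ⟨d, hd, hgap⟩ := hP.separated
  have hgap' := MottWalk.ae_forall_le_gap hP.ergodic.toMeasurePreserving hgap
  have hu : ∀ a b a' b', u a b ≤ u a' b' + (umax - umin) := fun a b a' b' => by
    linarith [(hub a b).2, (hub a' b').1]
  have hiff := MottWalk.lintegral_inv_crossing_eq_top_iff hu hgap' hd hlam_pos hlam_lt
  -- `crossing` and `barrier` at `0` unfold definitionally to the expressions in the statement, with
  -- `0 - 1` reducing to `-1`.
  exact ⟨fun h => MottWalk.hasVelocity_zero hP.ergodic hu_symm hu hgap' hd hlam_pos hlam_lt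
    (hiff.1 h), hiff⟩
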